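/- Let $F(a,b;c;x)=\sum_{n\ge 0}\frac{(a)_n (b)_n}{(c)_n\, n!}x^n$ ($|x|<1$) be the Gauss hypergeometric function. Let $\kappa\in(0,1)$ and set $$K=\int_0^{\pi/2}F\big(\tfrac16,\tfrac56;\tfrac12;\kappa^2\sin^2 t\big)\,dt .$$ Let $\alpha\in(0,\tfrac{\pi}{2})$ be defined by $\kappa=\sin\alpha$ and let $\beta\in(0,\tfrac{\pi}{3})$ be defined by $3\beta=2\alpha$. Then $$K=(1-k^2+k^4)^{1/4}\,\tfrac12\pi\,F\big(\tfrac12,\tfrac12;1;k^2\big),$$ where the modulus $k\in(0,1)$ is given by $$k^2=2\,\frac{\sin\beta}{\sin\beta+\sqrt3\,\cos\beta}.$$ -/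

import Mathlib

open Real

/-- The incomplete integral `f(T) = ∫₀ᵀ F(1/6, 5/6; 1/2; κ² sin² t) dt` in signature six, for the
modulus `κ`, where `F` is the Gauss hypergeometric function. -/
noncomputable def sigSixIntegral (κ T : ℝ) : ℝ :=
  ∫ t in (0 : ℝ)..T, ordinaryHypergeometric (1 / 6 : ℝ) (5 / 6) (1 / 2) (κ ^ 2 * sin t ^ 2)

/-- The complete integral `K = f(π/2)` in signature six, for the modulus `κ`. -/
noncomputable def sigSixK (κ : ℝ) : ℝ := sigSixIntegral κ (π / 2)

/-! Wallis' integrals turn the lower parameter 1/2 into 1, so K = (π/2) F(1/6, 5/6; 1; κ²)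
(`sigSixK_eq`). With p = sin(β + π/3), one has κ² = (1 - cos 3β)/2, k² = sin β / p and (1 - k² +
k⁴)^(1/4) = √(√3/2) / √p. It remains to compare √p F(1/6, 5/6; 1; κ²) with F(1/2, 1/2; 1; k²) as
functions of β. Both satisfy one second-order linear equation and are regular at its singular point
β = 0, so their weighted Wronskian vanishes and their ratio keeps its value √(√3/2) at 0
(`sqrt_sin_mul_ordinaryHypergeometric_eq`). -/

/-- A real power series with coefficients bounded by one is summable on the open unit interval. -/
theorem summable_mul_pow_of_abs_le_one {c : ℕ → ℝ} (hc : ∀ n, |c n| ≤ 1) {x : ℝ} (hx : |x| < 1) :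
    Summable fun n => c n * x ^ n := by
  refine Summable.of_norm_bounded (summable_geometric_of_lt_one (abs_nonneg x) hx) fun n => ?_
  rw [Real.norm_eq_abs, abs_mul, abs_pow]
  exact mul_le_of_le_one_left (by positivity) (hc n)

/-- Termwise differentiation of a real power series with coefficients bounded by one. -/
theorem hasDerivAt_tsum_mul_pow {c : ℕ → ℝ} (hc : ∀ n, |c n| ≤ 1) {x : ℝ} (hx : |x| < 1) :
    HasDerivAt (fun z => ∑' n, c n * z ^ n) (∑' n : ℕ, c n * (n * x ^ (n - 1))) x := by
  obtain ⟨r, hxr, hr⟩ := exists_between hx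
  have hr0 : 0 < r := (abs_nonneg x).trans_lt hxr
  have hu : Summable fun n : ℕ => (n : ℝ) * r ^ (n - 1) := by
    rw [← summable_nat_add_iff 1]
    have h1 := summable_pow_mul_geometric_of_norm_lt_one 1
      (show ‖r‖ < 1 by rwa [Real.norm_eq_abs, abs_of_pos hr0])
    have h2 := summable_geometric_of_lt_one hr0.le hr
    refine (h1.add h2).congr fun n => ?_
    push_cast
    ring
  refine hasDerivAt_tsum_of_isPreconnected (t := Set.Ioo (-r) r) (y₀ := 0) hu isOpen_Ioo
    isPreconnected_Ioo (fun n y _ => (hasDerivAt_pow n y).const_mul (c n)) (fun n y hy => ?_)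
    ⟨by linarith, hr0⟩ (summable_mul_pow_of_abs_le_one hc (by simp)) (abs_lt.mp hxr)
  rw [Real.norm_eq_abs, abs_mul, abs_mul, abs_pow, Nat.abs_cast]
  have hy' : |y| ≤ r := (abs_lt.mpr hy).le
  calc |c n| * (n * |y| ^ (n - 1)) ≤ 1 * (n * r ^ (n - 1)) := by
        gcongr
        exact hc n
    _ = _ := one_mul _

/-! ### Hypergeometric series and their differential equation -/

theorem ordinaryHypergeometric_eq_tsum_coefficient (a b d x : ℝ) :
    ordinaryHypergeometric a b d x =
      ∑' n, ordinaryHypergeometricCoefficient a b d n * x ^ n := by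
  rw [ordinaryHypergeometric_eq_tsum]
  simp [smul_eq_mul]

theorem ordinaryHypergeometricCoefficient_succ {a b d : ℝ} (hd : 0 < d) (n : ℕ) :
    ordinaryHypergeometricCoefficient a b d (n + 1) =
      ordinaryHypergeometricCoefficient a b d n * ((a + n) * (b + n) / ((d + n) * (n + 1))) := by
  have h1 := (ascPochhammer_pos n d hd).ne'
  have h2 : d + n ≠ 0 := by positivity
  simp only [ordinaryHypergeometricCoefficient, ascPochhammer_succ_eval, Nat.factorial_succ]
  push_cast
  have h3 : (n.factorial : ℝ) ≠ 0 := by positivity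
  field_simp

theorem ordinaryHypergeometricCoefficient_nonneg {a b d : ℝ} (ha : 0 < a) (hb : 0 < b)
    (hd : 0 < d) (n : ℕ) : 0 ≤ ordinaryHypergeometricCoefficient a b d n := by
  have h1 := ascPochhammer_pos n a ha
  have h2 := ascPochhammer_pos n b hb
  have h3 := ascPochhammer_pos n d hd
  unfold ordinaryHypergeometricCoefficient
  positivity

/-- Successive coefficients have ratio at most 1, because (d + n)(1 + n) - (a + n)(b + n) = (d - ab)
+ n(1 + d - a - b). -/
theorem abs_ordinaryHypergeometricCoefficient_le_one {a b d : ℝ} (ha : 0 < a) (hb : 0 < b)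
    (hd : 0 < d) (h : a + b ≤ 1 + d) (h' : a * b ≤ d) (n : ℕ) :
    |ordinaryHypergeometricCoefficient a b d n| ≤ 1 := by
  rw [abs_of_nonneg (ordinaryHypergeometricCoefficient_nonneg ha hb hd n)]
  induction n with
  | zero => simp [ordinaryHypergeometricCoefficient]
  | succ n ih =>
    rw [ordinaryHypergeometricCoefficient_succ hd]
    refine mul_le_one₀ ih (by positivity) ?_
    rw [div_le_one (by positivity)]
    have hn : (0 : ℝ) ≤ n := n.cast_nonneg
    nlinarith [mul_le_mul_of_nonneg_left h hn]

theorem ordinaryHypergeometric_pos {a b d x : ℝ} (ha : 0 < a) (hb : 0 < b)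
    (hd : 0 < d) (h : a + b ≤ 1 + d) (h' : a * b ≤ d) (hx0 : 0 ≤ x) (hx : x < 1) :
    0 < ordinaryHypergeometric a b d x := by
  rw [ordinaryHypergeometric_eq_tsum_coefficient]
  have hs := summable_mul_pow_of_abs_le_one
    (abs_ordinaryHypergeometricCoefficient_le_one ha hb hd h h') (abs_lt.mpr ⟨by linarith, hx⟩)
  refine hs.tsum_pos (fun n => mul_nonneg
    (ordinaryHypergeometricCoefficient_nonneg ha hb hd n) (pow_nonneg hx0 n)) 0 ?_
  simp [ordinaryHypergeometricCoefficient]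

theorem differentiableAt_ordinaryHypergeometric {a b d x : ℝ} (ha : 0 < a) (hb : 0 < b)
    (hd : 0 < d) (h : a + b ≤ 1 + d) (h' : a * b ≤ d) (hx : |x| < 1) :
    DifferentiableAt ℝ (ordinaryHypergeometric a b d : ℝ → ℝ) x := by
  rw [funext (ordinaryHypergeometric_eq_tsum_coefficient a b d)]
  exact (hasDerivAt_tsum_mul_pow
    (abs_ordinaryHypergeometricCoefficient_le_one ha hb hd h h') hx).differentiableAt

/-- The hypergeometric differential equation in self-adjoint form, for `c = a + b = 1`. -/
theorem hasDerivAt_mul_deriv_ordinaryHypergeometric {a b x : ℝ} (ha : 0 < a) (hb : 0 < b)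
    (hab : a + b = 1) (hx : |x| < 1) :
    HasDerivAt (fun z => z * (1 - z) * deriv (ordinaryHypergeometric a b 1 : ℝ → ℝ) z)
      (a * b * ordinaryHypergeometric a b 1 x) x := by
  set c := ordinaryHypergeometricCoefficient a b (1 : ℝ) with hcdef
  have hc : ∀ n, |c n| ≤ 1 :=
    abs_ordinaryHypergeometricCoefficient_le_one ha hb one_pos (by linarith) (by nlinarith)
  have hrec (n : ℕ) : c (n + 1) * (n + 1) ^ 2 = c n * ((a + n) * (b + n)) := by
    rw [hcdef, ordinaryHypergeometricCoefficient_succ one_pos, ← hcdef]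
    field_simp
    ring
  -- Coefficients of the antiderivative of F vanishing at 0; at n = 0, division by zero gives the
  -- required 0.
  have hd (n : ℕ) : |c (n - 1) / n| ≤ 1 := by
    rcases n with _ | n
    · simp
    · rw [abs_div, Nat.abs_cast]
      exact div_le_one_of_le₀ ((hc _).trans (by simp)) (by positivity)
  have hF : (ordinaryHypergeometric a b 1 : ℝ → ℝ) = fun z => ∑' n, c n * z ^ n :=
    funext (ordinaryHypergeometric_eq_tsum_coefficient a b 1)
  clear_value c
  have hw := (hasDerivAt_tsum_mul_pow hd hx).const_mul (a * b)
  have hval : ∑' n : ℕ, c (n - 1) / n * (n * x ^ (n - 1)) = ∑' n, c n * x ^ n := by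
    rw [tsum_eq_zero_add' ]
    · simp only [Nat.cast_zero, zero_mul, mul_zero, zero_add, Nat.add_sub_cancel]
      refine tsum_congr fun n => ?_
      push_cast
      field_simp
    · refine (summable_mul_pow_of_abs_le_one hc hx).congr fun n => ?_
      simp only [Nat.add_sub_cancel]
      push_cast
      field_simp
  rw [hval] at hw
  rw [hF]
  refine hw.congr_of_eventuallyEq ?_
  filter_upwards [(isOpen_lt continuous_abs continuous_const).mem_nhds hx] with z hz
  replace hz : |z| < 1 := hz
  rw [(hasDerivAt_tsum_mul_pow hc hz).deriv]
  have hs1 : Summable fun n : ℕ => (n : ℝ) * |z| ^ n := by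
    simpa using summable_pow_mul_geometric_of_norm_lt_one 1 (show ‖|z|‖ < 1 by simpa using hz)
  have hs2 : Summable fun n : ℕ => c n * (n * z ^ n) := by
    refine Summable.of_norm_bounded hs1 fun n => ?_
    rw [Real.norm_eq_abs, abs_mul, abs_mul, abs_pow, Nat.abs_cast]
    exact mul_le_of_le_one_left (by positivity) (hc n)
  have hs3 := (summable_nat_add_iff 1).mpr hs2
  have hθ : z * ∑' n : ℕ, c n * (n * z ^ (n - 1)) = ∑' n : ℕ, c n * (n * z ^ n) := by
    rw [← tsum_mul_left]
    refine tsum_congr fun n => ?_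
    rcases n with _ | n
    · simp
    · simp only [Nat.add_sub_cancel]
      ring
  calc z * (1 - z) * ∑' n : ℕ, c n * (n * z ^ (n - 1))
      = (∑' n : ℕ, c n * (n * z ^ n)) - z * ∑' n : ℕ, c n * (n * z ^ n) := by
        rw [← hθ]; ring
    _ = (∑' n : ℕ, c (n + 1) * ((n + 1 : ℕ) * z ^ (n + 1)))
          - ∑' n : ℕ, z * (c n * (n * z ^ n)) := by
        rw [tsum_mul_left, hs2.tsum_eq_zero_add]
        simp
    _ = ∑' n : ℕ, a * b * (c n / (n + 1 : ℕ) * z ^ (n + 1)) := by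
        rw [← hs3.tsum_sub (hs2.mul_left z)]
        refine tsum_congr fun n => ?_
        have h1 : (n + 1 : ℝ) ≠ 0 := by positivity
        have h2 : c (n + 1) = c n * ((a + n) * (b + n)) / (n + 1) ^ 2 := by
          rw [← hrec]; field_simp
        rw [h2]
        push_cast
        field_simp
        -- With a + b = 1, (a + n)(b + n) - n(n + 1) collapses to ab.
        rw [show b = 1 - a by linarith]
        ring
    _ = a * b * ∑' n : ℕ, c (n - 1) / n * z ^ n := by
        rw [tsum_mul_left, (summable_mul_pow_of_abs_le_one hd hz).tsum_eq_zero_add]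
        simp

/-! ### Reduction of the complete integral -/

theorem integral_sin_pow_two_mul_mul_ascPochhammer (n : ℕ) :
    (∫ t in (0 : ℝ)..π / 2, sin t ^ (2 * n)) * (ascPochhammer ℝ n).eval 1 =
      π / 2 * (ascPochhammer ℝ n).eval (1 / 2) := by
  induction n with
  | zero => simp
  | succ n ih =>
    rw [mul_add, mul_one, integral_sin_pow, ascPochhammer_succ_eval, ascPochhammer_succ_eval,
      ← mul_assoc (π / 2), ← ih]
    simp only [sin_zero, cos_pi_div_two]
    push_cast
    have : (2 * n + 2 : ℝ) ≠ 0 := by positivity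
    field_simp
    simp
    ring

theorem sigSixK_eq {κ : ℝ} (hκ : κ ∈ Set.Ioo (0 : ℝ) 1) :
    sigSixK κ = π / 2 * ordinaryHypergeometric (1 / 6 : ℝ) (5 / 6) 1 (κ ^ 2) := by
  have hκ2 : κ ^ 2 < 1 := pow_lt_one₀ hκ.1.le hκ.2 two_ne_zero
  have hc := abs_ordinaryHypergeometricCoefficient_le_one (a := 1 / 6) (b := 5 / 6) (d := 1 / 2)
    (by norm_num) (by norm_num) (by norm_num) (by norm_num) (by norm_num)
  set c := ordinaryHypergeometricCoefficient (1 / 6 : ℝ) (5 / 6) (1 / 2) with hcdef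
  have hsum : HasSum
      (fun n => ∫ t in (0 : ℝ)..π / 2, c n * (κ ^ 2 * sin t ^ 2) ^ n) (sigSixK κ) := by
    unfold sigSixK sigSixIntegral
    simp only [ordinaryHypergeometric_eq_tsum_coefficient]
    have hb (t : ℝ) : |κ ^ 2 * sin t ^ 2| ≤ κ ^ 2 := by
      rw [abs_of_nonneg (by positivity)]
      exact mul_le_of_le_one_right (by positivity) (sin_sq_le_one t)
    refine intervalIntegral.hasSum_integral_of_dominated_convergence
      (fun n _ => (κ ^ 2) ^ n) (fun n => ?_) (fun n => ?_) ?_ ?_ ?_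
    · exact (by fun_prop : Continuous fun t : ℝ =>
        c n * (κ ^ 2 * sin t ^ 2) ^ n).aestronglyMeasurable
    · filter_upwards with t _
      rw [Real.norm_eq_abs, abs_mul, abs_pow]
      exact (mul_le_of_le_one_left (by positivity) (hc n)).trans
        (pow_le_pow_left₀ (abs_nonneg _) (hb t) n)
    · filter_upwards with t _
      exact summable_geometric_of_lt_one (sq_nonneg κ) hκ2
    · exact intervalIntegrable_const
    · filter_upwards with t _
      exact (summable_mul_pow_of_abs_le_one hc ((hb t).trans_lt hκ2)).hasSum
  rw [← hsum.tsum_eq, ordinaryHypergeometric_eq_tsum_coefficient, ← tsum_mul_left]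
  refine tsum_congr fun n => ?_
  have h1 := ascPochhammer_pos n (1 : ℝ) one_pos
  have h2 := ascPochhammer_pos n (1 / 2 : ℝ) (by norm_num)
  have hI : (∫ t in (0 : ℝ)..π / 2, sin t ^ (2 * n)) =
      π / 2 * (ascPochhammer ℝ n).eval (1 / 2) / (ascPochhammer ℝ n).eval 1 := by
    rw [← integral_sin_pow_two_mul_mul_ascPochhammer]
    field_simp
  simp only [mul_pow, ← pow_mul, intervalIntegral.integral_const_mul, hI]
  simp only [hcdef, ordinaryHypergeometricCoefficient]
  field_simp

/-! ### Trigonometric parametrization -/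

theorem four_mul_sin_mul_sin_mul_sin (t : ℝ) :
    4 * (sin t * sin (t + π / 3) * sin (π / 3 - t)) = sin (3 * t) := by
  rw [sin_add, sin_sub, sin_pi_div_three, cos_pi_div_three, sin_three_mul]
  have h3 : √3 ^ 2 = 3 := sq_sqrt (by norm_num)
  linear_combination sin t * cos t ^ 2 * h3 + 3 * sin t * sin_sq_add_cos_sq t

theorem one_sub_sin_div_sin {t : ℝ} (ht : sin (t + π / 3) ≠ 0) :
    1 - sin t / sin (t + π / 3) = sin (π / 3 - t) / sin (t + π / 3) := by
  rw [one_sub_div ht]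
  congr 1
  rw [sin_add, sin_sub, sin_pi_div_three, cos_pi_div_three]
  ring

/-- This is the law of cosines for angles t, π/3, 2π/3 - t and circumdiameter 1. -/
theorem one_sub_sq_add_pow_four_of_sq_eq {t k : ℝ} (ht : sin (t + π / 3) ≠ 0)
    (hk : k ^ 2 = sin t / sin (t + π / 3)) :
    1 - k ^ 2 + k ^ 4 = (√3 / 2 / sin (t + π / 3)) ^ 2 := by
  rw [show k ^ 4 = (k ^ 2) ^ 2 by ring, hk]
  have h3 : √3 ^ 2 = 3 := sq_sqrt (by norm_num)
  have h : sin (t + π / 3) ^ 2 - sin t * sin (t + π / 3) + sin t ^ 2 = √3 ^ 2 / 4 := by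
    rw [sin_add, sin_pi_div_three, cos_pi_div_three]
    linear_combination (cos t ^ 2 - 1) / 4 * h3 + 3 / 4 * sin_sq_add_cos_sq t
  generalize sin (t + π / 3) = p at *
  field_simp
  linear_combination 4 * h

theorem hasDerivAt_sin_div_sin {t : ℝ} (ht : sin (t + π / 3) ≠ 0) :
    HasDerivAt (fun t => sin t / sin (t + π / 3)) (√3 / 2 / sin (t + π / 3) ^ 2) t := by
  refine ((hasDerivAt_sin t).div (((hasDerivAt_id t).add_const (π / 3)).sin) ht).congr_deriv ?_
  simp only [id]
  congr 1
  rw [sin_add, cos_add, sin_pi_div_three, cos_pi_div_three]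
  linear_combination √3 / 2 * sin_sq_add_cos_sq t

theorem hasDerivAt_one_sub_cos_three_mul (t : ℝ) :
    HasDerivAt (fun t => (1 - cos (3 * t)) / 2) (3 / 2 * sin (3 * t)) t := by
  refine (((((hasDerivAt_id t).const_mul 3).cos).const_sub 1).div_const 2).congr_deriv ?_
  simp only [id]
  ring

/-! ### The Wronskian argument -/

/-- The signature six function `F(1/6, 5/6; 1; ·)` equals the classical `F(1/2, 1/2; 1; ·)`
up to an algebraic factor, in trigonometric parametrization. -/
theorem sqrt_sin_mul_ordinaryHypergeometric_eq {β : ℝ} (hβ : β ∈ Set.Ioo 0 (π / 3)) :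
    √(sin (β + π / 3)) * ordinaryHypergeometric (1 / 6 : ℝ) (5 / 6) 1 ((1 - cos (3 * β)) / 2) =
      √(√3 / 2) * ordinaryHypergeometric (1 / 2 : ℝ) (1 / 2) 1 (sin β / sin (β + π / 3)) := by
  set f : ℝ → ℝ := ordinaryHypergeometric (1 / 2 : ℝ) (1 / 2) 1 with hf
  set u : ℝ → ℝ := ordinaryHypergeometric (1 / 6 : ℝ) (5 / 6) 1 with hu
  have hS1 {t : ℝ} (ht : t ∈ Set.Icc 0 β) : 0 < sin (t + π / 3) :=
    sin_pos_of_pos_of_lt_pi (by linarith [ht.1, pi_pos]) (by linarith [ht.2, hβ.2, pi_pos])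
  have hS2 {t : ℝ} (ht : t ∈ Set.Icc 0 β) : 0 < sin (π / 3 - t) :=
    sin_pos_of_pos_of_lt_pi (by linarith [ht.2, hβ.2]) (by linarith [ht.1, pi_pos])
  have hS0 {t : ℝ} (ht : t ∈ Set.Icc 0 β) : 0 ≤ sin t :=
    sin_nonneg_of_nonneg_of_le_pi ht.1 (by linarith [ht.2, hβ.2, pi_pos])
  have hS0' {t : ℝ} (ht : t ∈ Set.Ioo 0 β) : 0 < sin t :=
    sin_pos_of_pos_of_lt_pi ht.1 (by linarith [ht.2, hβ.2, pi_pos])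
  have hl0 {t : ℝ} (ht : t ∈ Set.Icc 0 β) : 0 ≤ sin t / sin (t + π / 3) :=
    div_nonneg (hS0 ht) (hS1 ht).le
  have hl1 {t : ℝ} (ht : t ∈ Set.Icc 0 β) : sin t / sin (t + π / 3) < 1 := by
    have := div_pos (hS2 ht) (hS1 ht)
    rw [← one_sub_sin_div_sin (hS1 ht).ne'] at this
    linarith
  have hl {t : ℝ} (ht : t ∈ Set.Icc 0 β) : |sin t / sin (t + π / 3)| < 1 :=
    abs_lt.mpr ⟨by linarith [hl0 ht], hl1 ht⟩
  have hx {t : ℝ} (ht : t ∈ Set.Icc 0 β) : |(1 - cos (3 * t)) / 2| < 1 := by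
    have h1 : cos π < cos (3 * t) :=
      cos_lt_cos_of_nonneg_of_le_pi (by linarith [ht.1]) le_rfl (by linarith [ht.2, hβ.2])
    rw [cos_pi] at h1
    rw [abs_lt]
    constructor <;> linarith [cos_le_one (3 * t)]
  have hfpos {t : ℝ} (ht : t ∈ Set.Icc 0 β) : 0 < f (sin t / sin (t + π / 3)) :=
    ordinaryHypergeometric_pos (by norm_num) (by norm_num) (by norm_num) (by norm_num)
      (by norm_num) (hl0 ht) (hl1 ht)
  have hF {t : ℝ} (ht : t ∈ Set.Icc 0 β) :
      HasDerivAt (fun t => f (sin t / sin (t + π / 3)))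
        (deriv f (sin t / sin (t + π / 3)) * (√3 / 2 / sin (t + π / 3) ^ 2)) t :=
    HasDerivAt.comp t (differentiableAt_ordinaryHypergeometric (by norm_num) (by norm_num)
      (by norm_num) (by norm_num) (by norm_num) (hl ht)).hasDerivAt
      (hasDerivAt_sin_div_sin (hS1 ht).ne')
  have hU {t : ℝ} (ht : t ∈ Set.Icc 0 β) :
      HasDerivAt (fun t => u ((1 - cos (3 * t)) / 2))
        (deriv u ((1 - cos (3 * t)) / 2) * (3 / 2 * sin (3 * t))) t :=
    HasDerivAt.comp t (differentiableAt_ordinaryHypergeometric (by norm_num) (by norm_num)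
      (by norm_num) (by norm_num) (by norm_num) (hx ht)).hasDerivAt
      (hasDerivAt_one_sub_cos_three_mul t)
  set gf : ℝ → ℝ := fun z => z * (1 - z) * deriv f z with hgf
  set gu : ℝ → ℝ := fun z => z * (1 - z) * deriv u z with hgu
  have hGF {t : ℝ} (ht : t ∈ Set.Icc 0 β) :
      HasDerivAt (fun t => gf (sin t / sin (t + π / 3)))
        (1 / 2 * (1 / 2) * f (sin t / sin (t + π / 3)) * (√3 / 2 / sin (t + π / 3) ^ 2)) t :=
    HasDerivAt.comp t (hasDerivAt_mul_deriv_ordinaryHypergeometric (by norm_num) (by norm_num)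
      (by norm_num) (hl ht)) (hasDerivAt_sin_div_sin (hS1 ht).ne')
  have hGU {t : ℝ} (ht : t ∈ Set.Icc 0 β) :
      HasDerivAt (fun t => gu ((1 - cos (3 * t)) / 2))
        (1 / 6 * (5 / 6) * u ((1 - cos (3 * t)) / 2) * (3 / 2 * sin (3 * t))) t :=
    HasDerivAt.comp t (hasDerivAt_mul_deriv_ordinaryHypergeometric (by norm_num) (by norm_num)
      (by norm_num) (hx ht)) (hasDerivAt_one_sub_cos_three_mul t)
  have hgfF {t : ℝ} (ht : t ∈ Set.Icc 0 β) : gf (sin t / sin (t + π / 3)) =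
      sin t * sin (π / 3 - t) / sin (t + π / 3) ^ 2 * deriv f (sin t / sin (t + π / 3)) := by
    simp only [hgf]
    rw [one_sub_sin_div_sin (hS1 ht).ne']
    ring
  have hguU (t : ℝ) : gu ((1 - cos (3 * t)) / 2) =
      sin t * sin (t + π / 3) * sin (π / 3 - t) * sin (3 * t) *
        deriv u ((1 - cos (3 * t)) / 2) := by
    simp only [hgu]
    linear_combination (-1 / 4 * deriv u ((1 - cos (3 * t)) / 2)) *
      (sin_sq_add_cos_sq (3 * t) + sin (3 * t) * four_mul_sin_mul_sin_mul_sin t)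
  have hdS1 (t : ℝ) : HasDerivAt (fun t => sin (t + π / 3)) (cos (t + π / 3)) t := by
    simpa using ((hasDerivAt_id t).add_const (π / 3)).sin
  have hdC1 (t : ℝ) : HasDerivAt (fun t => cos (t + π / 3)) (-sin (t + π / 3)) t := by
    simpa using ((hasDerivAt_id t).add_const (π / 3)).cos
  have hdS2 (t : ℝ) : HasDerivAt (fun t => sin (π / 3 - t)) (-cos (π / 3 - t)) t := by
    simpa using ((hasDerivAt_id t).const_sub (π / 3)).sin
  have hdsqrt {t : ℝ} (ht : t ∈ Set.Icc 0 β) : HasDerivAt (fun t => √(sin (t + π / 3)))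
      (cos (t + π / 3) / (2 * √(sin (t + π / 3)))) t := (hdS1 t).sqrt (hS1 ht).ne'
  -- the Wronskian of `√(sin (t + π / 3)) * u` and `f`, up to a factor
  set E : ℝ → ℝ := fun t => f (sin t / sin (t + π / 3)) * (3 / 2 * gu ((1 - cos (3 * t)) / 2) +
      1 / 2 * (sin t * sin (π / 3 - t) * cos (t + π / 3)) * u ((1 - cos (3 * t)) / 2)) -
      sin (t + π / 3) * (√3 / 2 * gf (sin t / sin (t + π / 3))) * u ((1 - cos (3 * t)) / 2)
    with hE
  have hdE {t : ℝ} (ht : t ∈ Set.Icc 0 β) :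
      HasDerivAt E (cos (t + π / 3) / (2 * sin (t + π / 3)) * E t) t := by
    have := ((hF ht).mul (((hGU ht).const_mul (3 / 2)).add
      (((((hasDerivAt_sin t).mul (hdS2 t)).mul (hdC1 t)).const_mul (1 / 2)).mul (hU ht)))).sub
      (((hdS1 t).mul ((hGF ht).const_mul (√3 / 2))).mul (hU ht))
    refine this.congr_deriv ?_
    clear this
    simp only [hE, Pi.mul_apply, Pi.add_apply]
    rw [hgfF ht, hguU, ← four_mul_sin_mul_sin_mul_sin]
    have h1 := (hS1 ht).ne'
    have h3 : √3 ^ 2 = 3 := sq_sqrt (by norm_num)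
    -- After the terms in `du` and `df` are matched, this says that the coefficient of `U * F`
    -- vanishes.
    have key : 3 / 4 * (sin t * sin (t + π / 3) ^ 2 * sin (π / 3 - t)) +
        1 / 2 * ((cos t * sin (π / 3 - t) - sin t * cos (π / 3 - t)) * cos (t + π / 3) *
          sin (t + π / 3)) - 3 / 16 = 1 / 4 * (sin t * sin (π / 3 - t) * cos (t + π / 3) ^ 2) := by
      rw [sin_add, cos_add, sin_sub, cos_sub, sin_pi_div_three, cos_pi_div_three]
      linear_combination (3 / 32 * sin t * (√3 * cos t ^ 3 + cos t ^ 2 * sin t) +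
        1 / 16 * ((cos t ^ 2 - sin t ^ 2) ^ 2 -
          √3 * (cos t ^ 2 - sin t ^ 2) * (sin t * cos t) + 2 * (sin t * cos t) ^ 2) -
        sin t / 32 * (-2 * cos t ^ 2 * sin t + √3 * cos t * sin t ^ 2 - sin t ^ 3)) * h3 +
        3 / 16 * (sin t ^ 2 + cos t ^ 2 + 1) * sin_sq_add_cos_sq t
    generalize deriv u ((1 - cos (3 * t)) / 2) = du
    generalize deriv f (sin t / sin (t + π / 3)) = df
    generalize f (sin t / sin (t + π / 3)) = F at *
    generalize u ((1 - cos (3 * t)) / 2) = U at *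
    generalize sin (t + π / 3) = p at *
    generalize cos (t + π / 3) = q at *
    generalize sin (π / 3 - t) = m at *
    generalize cos (π / 3 - t) = n at *
    field_simp
    linear_combination 576 * U * F * p * key - 36 * p * F * U * h3
  have hE0 {t : ℝ} (ht : t ∈ Set.Icc 0 β) : E t = 0 := by
    have hW {t : ℝ} (ht : t ∈ Set.Icc 0 β) :
        HasDerivAt (fun t => E t / √(sin (t + π / 3))) 0 t := by
      have h1 := hS1 ht
      have h2 := sqrt_pos.mpr h1
      refine ((hdE ht).div (hdsqrt ht) h2.ne').congr_deriv ?_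
      have h3 : √(sin (t + π / 3)) ^ 2 = sin (t + π / 3) := sq_sqrt h1.le
      generalize sin (t + π / 3) = p at *
      generalize √p = r at *
      subst h3
      field_simp
      ring
    -- Every term carries a factor vanishing at the singular point t = 0.
    have h0 : E 0 = 0 := by simp [hE, hgf, hgu]
    have := constant_of_has_deriv_right_zero
      (fun s hs => (hW hs).continuousAt.continuousWithinAt)
      (fun s hs => (hW (Set.Ico_subset_Icc_self hs)).hasDerivWithinAt) t ht
    rw [h0, zero_div, div_eq_zero_iff] at this
    exact this.resolve_right (sqrt_pos.mpr (hS1 ht)).ne'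
  have hR {t : ℝ} (ht : t ∈ Set.Icc 0 β) :=
    ((hdsqrt ht).mul (hU ht)).div (hF ht) (hfpos ht).ne'
  have hβ0 : β ∈ Set.Icc 0 β := ⟨hβ.1.le, le_rfl⟩
  -- By the mean value theorem, a zero derivative of the ratio at one interior point already equates
  -- its values at 0 and β.
  obtain ⟨t, ht, hslope⟩ := exists_hasDerivAt_eq_slope _ _ hβ.1
    (fun s hs => (hR hs).continuousAt.continuousWithinAt)
    (fun s hs => hR (Set.Ioo_subset_Icc_self hs))
  have ht' := Set.Ioo_subset_Icc_self ht
  have hzero := hE0 ht'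
  simp only [hE] at hzero
  rw [hgfF ht', hguU] at hzero
  have h0 := hS0' ht
  have h1 := hS1 ht'
  have h2 := hS2 ht'
  have h3 := sqrt_pos.mpr h1
  have h4 := sq_sqrt h1.le
  have hF' := hfpos ht'
  have hnum : (cos (t + π / 3) / (2 * √(sin (t + π / 3))) * u ((1 - cos (3 * t)) / 2) +
        √(sin (t + π / 3)) * (deriv u ((1 - cos (3 * t)) / 2) * (3 / 2 * sin (3 * t)))) *
        f (sin t / sin (t + π / 3)) -
      √(sin (t + π / 3)) * u ((1 - cos (3 * t)) / 2) *
        (deriv f (sin t / sin (t + π / 3)) * (√3 / 2 / sin (t + π / 3) ^ 2)) = 0 := by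
    clear hslope
    generalize deriv u ((1 - cos (3 * t)) / 2) = du at *
    generalize deriv f (sin t / sin (t + π / 3)) = df at *
    generalize f (sin t / sin (t + π / 3)) = F at *
    generalize u ((1 - cos (3 * t)) / 2) = U at *
    generalize sin (t + π / 3) = p at *
    generalize cos (t + π / 3) = q at *
    generalize sin (π / 3 - t) = m at *
    generalize √p = r at *
    subst h4
    -- The Wronskian factor is positive since t > 0, so it can be cancelled from `E t = 0`.
    refine (mul_eq_zero.mp (?_ : sin t * m * r * _ = 0)).resolve_left (by positivity)
    rw [← hzero]
    field_simp
    ring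
  simp only [Pi.mul_apply, Pi.div_apply] at hslope
  rw [hnum, zero_div, eq_comm, sub_zero, div_eq_zero_iff, or_iff_left hβ.1.ne', sub_eq_zero,
    div_eq_iff (hfpos hβ0).ne'] at hslope
  rw [hslope]
  simp [hf, hu]

theorem theorem7 (κ α β : ℝ) (hκ : κ ∈ Set.Ioo (0 : ℝ) 1) (hα : α ∈ Set.Ioo (0 : ℝ) (π / 2))
    (hκα : κ = sin α) (hβα : 3 * β = 2 * α) :
    ∃ k : ℝ, k ∈ Set.Ioo (0 : ℝ) 1 ∧
      k ^ 2 = 2 * (sin β / (sin β + √3 * cos β)) ∧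
      sigSixK κ = (1 - k ^ 2 + k ^ 4) ^ (1 / 4 : ℝ) *
        (π / 2 * ordinaryHypergeometric (1 / 2 : ℝ) (1 / 2) 1 (k ^ 2)) := by
  have hβ : β ∈ Set.Ioo 0 (π / 3) := ⟨by linarith [hα.1], by linarith [hα.2]⟩
  have h0 : 0 < sin β := sin_pos_of_pos_of_lt_pi hβ.1 (by linarith [hβ.2, pi_pos])
  have h1 : 0 < sin (β + π / 3) :=
    sin_pos_of_pos_of_lt_pi (by linarith [hβ.1, pi_pos]) (by linarith [hβ.2, pi_pos])
  have h2 : 0 < sin (π / 3 - β) :=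
    sin_pos_of_pos_of_lt_pi (by linarith [hβ.2]) (by linarith [hβ.1, pi_pos])
  have hl0 : 0 < sin β / sin (β + π / 3) := div_pos h0 h1
  have hl1 : sin β / sin (β + π / 3) < 1 := by
    have := div_pos h2 h1
    rw [← one_sub_sin_div_sin h1.ne'] at this
    linarith
  have hk : √(sin β / sin (β + π / 3)) ^ 2 = sin β / sin (β + π / 3) := sq_sqrt hl0.le
  refine ⟨√(sin β / sin (β + π / 3)), ⟨sqrt_pos.mpr hl0, ?_⟩, ?_, ?_⟩
  · rw [sqrt_lt' one_pos]
    simpa using hl1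
  · have h : sin β + √3 * cos β = 2 * sin (β + π / 3) := by
      rw [sin_add, sin_pi_div_three, cos_pi_div_three]
      ring
    rw [hk, h]
    field_simp
  · have hx : κ ^ 2 = (1 - cos (3 * β)) / 2 := by
      rw [hκα, hβα, cos_two_mul]
      linarith [sin_sq_add_cos_sq α]
    have hroot : ((√3 / 2 / sin (β + π / 3)) ^ 2) ^ (1 / 4 : ℝ) =
        √(√3 / 2) / √(sin (β + π / 3)) := by
      rw [← sqrt_div (by positivity), sqrt_eq_rpow (√3 / 2 / sin (β + π / 3)), ← rpow_natCast,
        ← rpow_mul (by positivity)]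
      norm_num
    rw [one_sub_sq_add_pow_four_of_sq_eq h1.ne' hk, hk, hroot, sigSixK_eq hκ, hx]
    have h3 := (sqrt_pos.mpr h1).ne'
    have := sqrt_sin_mul_ordinaryHypergeometric_eq hβ
    rw [div_mul_eq_mul_div (√(√3 / 2)), eq_div_iff h3]
    linear_combination π / 2 * this
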